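/- There exist universal constants $C,c>0$ such that the following holds. Let $\xi$ be a non-degenerate (i.e. not almost surely constant) real random variable with $\mathbb{E}[\xi]=0$ that is sub-Gaussian, i.e. $$\|\xi\|_{\psi_2}:=\inf\{\nu>0:\ \mathbb{E}[\exp(\xi^2/\nu^2)-1]\le 1\}<\infty ,$$ and put $K=\|\xi\|_{\psi_2}/\sqrt{\operatorname{Var}(\xi)}$. Let $n\ge 1$, let $X_1,\dots,X_n$ be independent copies of $\xi$, let $\mathbf{x}=(X_1,\dots,X_n)^\top$, and let $\mathbf{y}=\mathbf{x}/\|\mathbf{x}\|_2$ be the self-normalized vector (with $\mathbf{y}=0$ if $\mathbf{x}=0$). Then for every nonzero matrix $\mathbf{A}\in\mathbb{R}^{n\times n}$, with Euclidean operator norm $\|\mathbf{A}\|$, and every $t>0$, $$\mathbb{P}\left(\left|\mathbf{y}^\top\mathbf{A}\mathbf{y}-\mathbb{E}[\mathbf{y}^\top\mathbf{A}\mathbf{y}]\right|\ge t\right)\le C\exp\left(-c\min\left(\frac{nt^2}{K^4\|\mathbf{A}\|^2},\ \frac{nt}{K^2\|\mathbf{A}\|}\right)\right).$$ -/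

import Mathlib

open MeasureTheory ProbabilityTheory
open scoped ENNReal NNReal Matrix

/-- The Orlicz function `ψ₂(x) = exp(x²) - 1`. -/
noncomputable def psiTwo (x : ℝ) : ℝ := Real.exp (x ^ 2) - 1

/-- The sub-Gaussian norm `‖Z‖_{ψ₂} = inf {ν > 0 : E[ψ₂(|Z|/ν)] ≤ 1}`, with value `∞` if no such
`ν` exists.  Since `ψ₂ ≥ 0`, the expectation is a Lebesgue integral with values in `[0, ∞]`. -/
noncomputable def subGaussianNorm {Ω : Type*} [MeasurableSpace Ω] (Z : Ω → ℝ) (P : Measure Ω) :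
    ℝ≥0∞ :=
  ⨅ (ν : ℝ≥0) (_ : 0 < ν ∧ ∫⁻ ω, ENNReal.ofReal (psiTwo (|Z ω| / ν)) ∂P ≤ 1), (ν : ℝ≥0∞)

/-- A random variable is sub-Gaussian if its sub-Gaussian norm is finite. -/
def IsSubGaussian {Ω : Type*} [MeasurableSpace Ω] (Z : Ω → ℝ) (P : Measure Ω) : Prop :=
  subGaussianNorm Z P < ∞

/-- A random variable is non-degenerate if its law is not a Dirac measure. -/
def IsNondegenerate {Ω : Type*} [MeasurableSpace Ω] (Z : Ω → ℝ) (P : Measure Ω) : Prop :=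
  ∀ b : ℝ, P.map Z ≠ Measure.dirac b

/-- The self-normalization `x / ‖x‖₂` of a vector (equal to `0` for `x = 0`). -/
noncomputable def selfNormalize {n : ℕ} (x : Fin n → ℝ) : Fin n → ℝ :=
  fun i => x i / √(∑ j, x j ^ 2)

/-- The quadratic form `yᵀ A y`. -/
def quadForm {n : ℕ} (A : Matrix (Fin n) (Fin n) ℝ) (y : Fin n → ℝ) : ℝ :=
  y ⬝ᵥ (A *ᵥ y)

/-- The operator norm of a matrix with respect to the Euclidean norm. -/
noncomputable def matrixOpNorm {n : ℕ} (A : Matrix (Fin n) (Fin n) ℝ) : ℝ :=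
  ‖Matrix.toEuclideanCLM (n := Fin n) (𝕜 := ℝ) A‖

/-- `K = ‖ξ‖_{ψ₂} / √Var(ξ)`. -/
noncomputable def subGaussianRatio {Ω : Type*} [MeasurableSpace Ω] (ξ : Ω → ℝ) (P : Measure Ω) :
    ℝ :=
  (subGaussianNorm ξ P).toReal / √(Var[ξ; P])

/-! The vector y does not change when ξ is rescaled, so take Var ξ = 1, and write L for the operator
norm of A. Then yᵀAy − tr A/n = (xᵀAx − (tr A/n)‖x‖²)/‖x‖². The numerator is a centered quadratic
form whose diagonal coefficients sum to zero. The denominator exceeds n/2 with high probability,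
because ‖x‖² − n is a sum of centered squares.

The diagonal and off-diagonal parts of the numerator both have moment generating function at most
exp(200 n κ⁴ L² l²) for |l| L κ² ≤ 1/16 (`lintegral_exp_diagonal_le`,
`lintegral_exp_offDiagonal_le`). The off-diagonal part is decoupled by averaging over all splittings
of the coordinates into two blocks. Conditionally on one block, it is linear in the other.

Since |yᵀAy| and |tr A/n| are at most L, only t ≤ 2L matters. The Chernoff parameter then stays in
the Gaussian regime, and the first term of the minimum suffices. The mean of yᵀAy is never computed:
integrating the tail shows that it lies close enough to tr A/n to serve as the center. -/

/-- A law on the line with mean zero, variance one and sub-Gaussian norm at most `κ`. -/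
structure IsStdSubGaussian (μ : Measure ℝ) (κ : ℝ) : Prop where
  pos : 0 < κ
  mean : ∫ x, x ∂μ = 0
  sq : ∫ x, x ^ 2 ∂μ = 1
  exp_sq : ∫⁻ x, ENNReal.ofReal (Real.exp (x ^ 2 / κ ^ 2)) ∂μ ≤ 2

/-! ### Exponential moments of one coordinate -/

lemma exp_le_one_add_add_sq_mul_exp_abs (u : ℝ) :
    Real.exp u ≤ 1 + u + u ^ 2 * Real.exp |u| := by
  have h := Complex.norm_exp_sub_sum_le_norm_mul_exp (u : ℂ) 2
  simp only [Finset.sum_range_succ, Finset.sum_range_zero, pow_zero, Nat.factorial, pow_one,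
    Nat.cast_one, div_one, zero_add, mul_one, Complex.norm_real, Real.norm_eq_abs, sq_abs] at h
  have h2 : Complex.exp u - (1 + u) = ((Real.exp u - (1 + u) : ℝ) : ℂ) := by push_cast; rfl
  rw [h2, Complex.norm_real, Real.norm_eq_abs] at h
  linarith [le_abs_self (Real.exp u - (1 + u))]

/-- In the second-order Taylor bound the linear term integrates to zero, and 1 + s ≤ exp s turns the
remainder into an exponent. -/
lemma lintegral_exp_le_of_centered {α : Type*} [MeasurableSpace α] {μ : Measure α}
    [IsProbabilityMeasure μ] {Z G : α → ℝ} (hZ : Integrable Z μ) (hG : Integrable G μ)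
    (hZ0 : ∫ a, Z a ∂μ = 0) (h : ∀ a, Z a ^ 2 * Real.exp |Z a| ≤ G a) :
    ∫⁻ a, ENNReal.ofReal (Real.exp (Z a)) ∂μ ≤ ENNReal.ofReal (Real.exp (∫ a, G a ∂μ)) := by
  have hle : ∀ a, Real.exp (Z a) ≤ 1 + Z a + G a := fun a =>
    (exp_le_one_add_add_sq_mul_exp_abs _).trans (by linarith [h a])
  have hi : Integrable (fun a => 1 + Z a) μ := (integrable_const _).add hZ
  calc ∫⁻ a, ENNReal.ofReal (Real.exp (Z a)) ∂μ
      ≤ ∫⁻ a, ENNReal.ofReal (1 + Z a + G a) ∂μ :=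
        lintegral_mono fun a => ENNReal.ofReal_le_ofReal (hle a)
    _ = ENNReal.ofReal (∫ a, 1 + Z a + G a ∂μ) :=
        (ofReal_integral_eq_lintegral_ofReal (hi.add hG)
          (.of_forall fun a => (Real.exp_pos _).le.trans (hle a))).symm
    _ ≤ _ := by
        apply ENNReal.ofReal_le_ofReal
        rw [integral_add hi hG, integral_add (integrable_const _) hZ, hZ0]
        simp only [integral_const, probReal_univ, smul_eq_mul, mul_one, add_zero]
        linarith [Real.add_one_le_exp (∫ a, G a ∂μ)]

namespace IsStdSubGaussian

variable {μ : Measure ℝ} {κ : ℝ}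

lemma integrable_exp_sq (h : IsStdSubGaussian μ κ) :
    Integrable (fun x => Real.exp (x ^ 2 / κ ^ 2)) μ := by
  refine ⟨by fun_prop, ?_⟩
  rw [hasFiniteIntegral_iff_ofReal (.of_forall fun x => (Real.exp_pos _).le)]
  exact h.exp_sq.trans_lt (by simp)

lemma integral_exp_sq_le (h : IsStdSubGaussian μ κ) :
    ∫ x, Real.exp (x ^ 2 / κ ^ 2) ∂μ ≤ 2 := by
  rw [integral_eq_lintegral_of_nonneg_ae (.of_forall fun x => (Real.exp_pos _).le) (by fun_prop)]
  exact ENNReal.toReal_le_of_le_ofReal (by norm_num) (by simpa using h.exp_sq)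

lemma integrable_sq (h : IsStdSubGaussian μ κ) : Integrable (fun x => x ^ 2) μ := by
  by_contra hn
  simpa [integral_undef hn] using h.sq

lemma integrable_id [IsProbabilityMeasure μ] (h : IsStdSubGaussian μ κ) :
    Integrable (fun x => x) μ := by
  refine ((integrable_const (1 : ℝ)).add h.integrable_sq).mono' (by fun_prop)
    (.of_forall fun x => ?_)
  simp only [Real.norm_eq_abs, Pi.add_apply]
  exact abs_le.2 ⟨by nlinarith [sq_nonneg (x + 1)], by nlinarith [sq_nonneg (x - 1)]⟩

/-- Unit variance gives 1 + 1/κ² ≤ E exp(x²/κ²) ≤ 2. -/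
lemma one_le [IsProbabilityMeasure μ] (h : IsStdSubGaussian μ κ) : 1 ≤ κ := by
  have hk := h.pos
  have h1 : ∫ x, (1 + x ^ 2 / κ ^ 2) ∂μ ≤ ∫ x, Real.exp (x ^ 2 / κ ^ 2) ∂μ :=
    integral_mono ((integrable_const _).add (h.integrable_sq.div_const _)) h.integrable_exp_sq
      fun x => by
        have := Real.add_one_le_exp (x ^ 2 / κ ^ 2)
        simp only; linarith
  rw [integral_add (integrable_const _) (h.integrable_sq.div_const _), integral_div, h.sq] at h1
  simp only [integral_const, probReal_univ, smul_eq_mul, mul_one] at h1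
  have h2 : 1 / κ ^ 2 ≤ 1 := by linarith [h.integral_exp_sq_le]
  rw [div_le_one (by positivity)] at h2
  nlinarith

/-- The moment generating function of a sub-Gaussian variable. -/
lemma lintegral_exp_mul_le [IsProbabilityMeasure μ] (h : IsStdSubGaussian μ κ) (a : ℝ) :
    ∫⁻ x, ENNReal.ofReal (Real.exp (a * x)) ∂μ ≤ ENNReal.ofReal (Real.exp (8 * κ ^ 2 * a ^ 2)) := by
  have hk := h.pos
  -- For |aκ| ≤ 1 the Taylor remainder is at most 4(aκ)² exp(x²/κ²), whose mean is at most 8(aκ)².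
  -- For |aκ| ≥ 1, centering is not needed: ax ≤ (aκ)² + x²/κ², and the factor 2 is absorbed by exp
  -- 1.
  obtain hb | hb := le_total ((a * κ) ^ 2) 1
  · have hG : Integrable (fun x => 4 * (a * κ) ^ 2 * Real.exp (x ^ 2 / κ ^ 2)) μ :=
      h.integrable_exp_sq.const_mul _
    refine (lintegral_exp_le_of_centered (h.integrable_id.const_mul a) hG
      (by rw [integral_const_mul, h.mean, mul_zero]) fun x => ?_).trans ?_
    · obtain ⟨w, rfl⟩ : ∃ w, x = κ * w := ⟨x / κ, by field_simp⟩
      have e1 : (κ * w) ^ 2 / κ ^ 2 = w ^ 2 := by field_simp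
      rw [e1]
      have e2 : |a * (κ * w)| ≤ 1 / 2 + w ^ 2 / 2 := by
        rw [← mul_assoc]
        generalize a * κ = b at hb
        have : 0 ≤ (|b| - |w|) ^ 2 := sq_nonneg _
        rw [abs_mul]
        nlinarith [sq_abs b, sq_abs w]
      have e3 : Real.exp |a * (κ * w)| ≤ 2 * Real.exp (w ^ 2 / 2) := by
        refine (Real.exp_le_exp.2 e2).trans ?_
        rw [Real.exp_add]
        have : Real.exp (1 / 2) ≤ 2 := by
          have h3 : Real.exp (1 / 2) * Real.exp (1 / 2) = Real.exp 1 := by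
            rw [← Real.exp_add]; norm_num
          nlinarith [Real.exp_one_lt_three, Real.exp_pos (1 / 2)]
        gcongr
      have e4 : w ^ 2 ≤ 2 * Real.exp (w ^ 2 / 2) := by
        linarith [Real.add_one_le_exp (w ^ 2 / 2)]
      have e5 : Real.exp (w ^ 2) = Real.exp (w ^ 2 / 2) * Real.exp (w ^ 2 / 2) := by
        rw [← Real.exp_add]; ring_nf
      calc (a * (κ * w)) ^ 2 * Real.exp |a * (κ * w)|
          = (a * κ) ^ 2 * (w ^ 2 * Real.exp |a * (κ * w)|) := by ring
        _ ≤ (a * κ) ^ 2 * (2 * Real.exp (w ^ 2 / 2) * (2 * Real.exp (w ^ 2 / 2))) := by gcongr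
        _ = _ := by rw [e5]; ring
    · apply ENNReal.ofReal_le_ofReal
      apply Real.exp_le_exp.2
      rw [integral_const_mul]
      calc _ ≤ 4 * (a * κ) ^ 2 * 2 := by gcongr; exact h.integral_exp_sq_le
        _ = _ := by ring
  · calc ∫⁻ x, ENNReal.ofReal (Real.exp (a * x)) ∂μ
        ≤ ∫⁻ x, ENNReal.ofReal (Real.exp ((a * κ) ^ 2)) *
            ENNReal.ofReal (Real.exp (x ^ 2 / κ ^ 2)) ∂μ := by
          refine lintegral_mono fun x => ?_
          rw [← ENNReal.ofReal_mul (Real.exp_pos _).le, ← Real.exp_add]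
          apply ENNReal.ofReal_le_ofReal
          apply Real.exp_le_exp.2
          obtain ⟨w, rfl⟩ : ∃ w, x = κ * w := ⟨x / κ, by field_simp⟩
          have e1 : (κ * w) ^ 2 / κ ^ 2 = w ^ 2 := by field_simp
          rw [e1]
          nlinarith [sq_nonneg (a * κ - w), sq_nonneg (a * κ), sq_nonneg w]
      _ ≤ ENNReal.ofReal (Real.exp ((a * κ) ^ 2)) * 2 := by
          rw [lintegral_const_mul' _ _ (by simp)]
          gcongr
          exact h.exp_sq
      _ = ENNReal.ofReal (Real.exp ((a * κ) ^ 2) * 2) := by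
          rw [ENNReal.ofReal_mul (Real.exp_pos _).le]; simp
      _ ≤ _ := by
          apply ENNReal.ofReal_le_ofReal
          have : (2 : ℝ) ≤ Real.exp 1 := by linarith [Real.add_one_le_exp (1 : ℝ)]
          calc _ ≤ Real.exp ((a * κ) ^ 2) * Real.exp 1 := by gcongr
            _ = Real.exp ((a * κ) ^ 2 + 1) := (Real.exp_add _ _).symm
            _ ≤ _ := Real.exp_le_exp.2 (by nlinarith)

/-- The moment generating function of the centered square. -/
lemma lintegral_exp_mul_sq_sub_one_le [IsProbabilityMeasure μ] (h : IsStdSubGaussian μ κ) {θ : ℝ}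
    (hθ : |θ| * κ ^ 2 ≤ 1 / 2) :
    ∫⁻ x, ENNReal.ofReal (Real.exp (θ * (x ^ 2 - 1))) ∂μ ≤
      ENNReal.ofReal (Real.exp (48 * κ ^ 4 * θ ^ 2)) := by
  have hk := h.pos
  have hk1 := h.one_le
  -- With x = κw and v = w² + 1, the smallness of θ leaves v² exp(v/2) ≤ 8 exp v ≤ 24 exp(w²).
  have hG : Integrable (fun x => 24 * (|θ| * κ ^ 2) ^ 2 * Real.exp (x ^ 2 / κ ^ 2)) μ :=
    h.integrable_exp_sq.const_mul _
  have hs : Integrable (fun x : ℝ => x ^ 2 - 1) μ := h.integrable_sq.sub (integrable_const _)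
  refine (lintegral_exp_le_of_centered (hs.const_mul θ) hG ?_ fun x => ?_).trans ?_
  · rw [integral_const_mul, integral_sub h.integrable_sq (integrable_const _), h.sq]
    simp
  · obtain ⟨w, rfl⟩ : ∃ w, x = κ * w := ⟨x / κ, by field_simp⟩
    have e1 : (κ * w) ^ 2 / κ ^ 2 = w ^ 2 := by field_simp
    rw [e1]
    set v := w ^ 2 + 1 with hv
    have hv0 : 0 ≤ v := by positivity
    have e2 : |(κ * w) ^ 2 - 1| ≤ κ ^ 2 * v := by
      have : 1 ≤ κ ^ 2 := one_le_pow₀ hk1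
      have h3 : 0 ≤ (κ * w) ^ 2 := sq_nonneg _
      rw [hv]
      exact abs_le.2 ⟨by nlinarith, by nlinarith⟩
    have e3 : |θ * ((κ * w) ^ 2 - 1)| ≤ |θ| * κ ^ 2 * v := by
      rw [abs_mul, mul_assoc]; gcongr
    have e4 : v ^ 2 ≤ 8 * Real.exp (v / 2) := by
      nlinarith [Real.quadratic_le_exp_of_nonneg (show 0 ≤ v / 2 by positivity)]
    have e5 : Real.exp v ≤ 3 * Real.exp (w ^ 2) := by
      rw [hv, Real.exp_add, mul_comm]
      gcongr
      exact Real.exp_one_lt_three.le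
    have e6 : Real.exp (v / 2) * Real.exp (v / 2) = Real.exp v := by
      rw [← Real.exp_add]; ring_nf
    calc _ = |θ * ((κ * w) ^ 2 - 1)| ^ 2 * Real.exp |θ * ((κ * w) ^ 2 - 1)| := by rw [sq_abs]
      _ ≤ (|θ| * κ ^ 2 * v) ^ 2 * Real.exp (v / 2) := by
          gcongr
          exact e3.trans (by nlinarith)
      _ = (|θ| * κ ^ 2) ^ 2 * (v ^ 2 * Real.exp (v / 2)) := by ring
      _ ≤ (|θ| * κ ^ 2) ^ 2 * (8 * Real.exp (v / 2) * Real.exp (v / 2)) := by gcongr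
      _ = 8 * (|θ| * κ ^ 2) ^ 2 * Real.exp v := by rw [← e6]; ring
      _ ≤ 8 * (|θ| * κ ^ 2) ^ 2 * (3 * Real.exp (w ^ 2)) := by gcongr
      _ = _ := by ring
  · apply ENNReal.ofReal_le_ofReal
    apply Real.exp_le_exp.2
    rw [integral_const_mul]
    calc _ ≤ 24 * (|θ| * κ ^ 2) ^ 2 * 2 := by gcongr; exact h.integral_exp_sq_le
      _ = 48 * κ ^ 4 * |θ| ^ 2 := by ring
      _ = _ := by rw [sq_abs]

/-- The exponential moments of the square. -/
lemma lintegral_exp_mul_sq_le [IsProbabilityMeasure μ] (h : IsStdSubGaussian μ κ) {θ : ℝ}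
    (hθ0 : 0 ≤ θ) (hθ : θ * κ ^ 2 ≤ 1) :
    ∫⁻ x, ENNReal.ofReal (Real.exp (θ * x ^ 2)) ∂μ ≤ ENNReal.ofReal (Real.exp (θ * κ ^ 2)) := by
  have hk := h.pos
  have hi := h.integrable_exp_sq
  set p := θ * κ ^ 2 with hp
  have hp0 : 0 ≤ p := by positivity
  -- Since θx² = p · (x²/κ²) with p in [0, 1], the chord of exp bounds the left side. Its mean is at
  -- most 1 + p ≤ exp p.
  have hle : ∀ x : ℝ, Real.exp (θ * x ^ 2) ≤ (1 - p) + p * Real.exp (x ^ 2 / κ ^ 2) := fun x => by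
    have := convexOn_exp.2 (Set.mem_univ 0) (Set.mem_univ (x ^ 2 / κ ^ 2))
      (sub_nonneg.2 hθ) hp0 (by ring)
    simp only [smul_eq_mul, mul_zero, zero_add, Real.exp_zero, mul_one] at this
    rwa [show p * (x ^ 2 / κ ^ 2) = θ * x ^ 2 by rw [hp]; field_simp] at this
  calc _ ≤ ∫⁻ x, ENNReal.ofReal ((1 - p) + p * Real.exp (x ^ 2 / κ ^ 2)) ∂μ :=
        lintegral_mono fun x => ENNReal.ofReal_le_ofReal (hle x)
    _ = ENNReal.ofReal (∫ x, (1 - p) + p * Real.exp (x ^ 2 / κ ^ 2) ∂μ) :=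
        (ofReal_integral_eq_lintegral_ofReal ((integrable_const _).add (hi.const_mul p))
          (.of_forall fun a => (Real.exp_pos _).le.trans (hle a))).symm
    _ ≤ _ := by
        apply ENNReal.ofReal_le_ofReal
        rw [integral_add (integrable_const _) (hi.const_mul p), integral_const_mul]
        simp only [integral_const, probReal_univ, smul_eq_mul, one_mul]
        nlinarith [Real.add_one_le_exp p, h.integral_exp_sq_le]

end IsStdSubGaussian

/-! ### Independent coordinates and the diagonal part -/

lemma lintegral_pi_prod_eq {ι : Type*} [Fintype ι] (μ : Measure ℝ) [IsProbabilityMeasure μ]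
    (f : ι → ℝ → ℝ≥0∞) (hf : ∀ i, Measurable (f i)) :
    ∫⁻ x, ∏ i, f i (x i) ∂(Measure.pi fun _ : ι => μ) = ∏ i, ∫⁻ y, f i y ∂μ := by
  have hind : iIndepFun (fun i (x : ι → ℝ) => f i (x i)) (Measure.pi fun _ : ι => μ) :=
    iIndepFun_pi fun i => (hf i).aemeasurable
  rw [lintegral_prod_eq_prod_lintegral_of_indepFun Finset.univ _ hind
    fun i => (hf i).comp (measurable_pi_apply i)]
  refine Finset.prod_congr rfl fun i _ => ?_
  exact (measurePreserving_eval (fun _ : ι => μ) i).lintegral_comp (hf i)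

lemma lintegral_pi_exp_sum_le {ι : Type*} [Fintype ι] (μ : Measure ℝ) [IsProbabilityMeasure μ]
    (g : ι → ℝ → ℝ) (hg : ∀ i, Measurable (g i)) (b : ι → ℝ)
    (h : ∀ i, ∫⁻ y, ENNReal.ofReal (Real.exp (g i y)) ∂μ ≤ ENNReal.ofReal (Real.exp (b i))) :
    ∫⁻ x, ENNReal.ofReal (Real.exp (∑ i, g i (x i))) ∂(Measure.pi fun _ : ι => μ) ≤
      ENNReal.ofReal (Real.exp (∑ i, b i)) := by
  simp_rw [Real.exp_sum, ENNReal.ofReal_prod_of_nonneg fun i _ => (Real.exp_pos _).le]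
  rw [lintegral_pi_prod_eq μ (fun i y => ENNReal.ofReal (Real.exp (g i y)))
    fun i => (hg i).exp.ennreal_ofReal]
  exact Finset.prod_le_prod' fun i _ => h i

/-- The bound 2L accommodates the coefficients `A i i - A.trace / n`. The constant 48 · 4 = 192 is
rounded up to 200, which also serves the off-diagonal part. -/
lemma lintegral_exp_diagonal_le {μ : Measure ℝ} {κ : ℝ} [IsProbabilityMeasure μ]
    (h : IsStdSubGaussian μ κ) {n : ℕ} (d : Fin n → ℝ) {L l : ℝ}
    (hd : ∀ i, |d i| ≤ 2 * L) (hl : |l| * L * κ ^ 2 ≤ 1 / 16) :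
    ∫⁻ x, ENNReal.ofReal (Real.exp (l * ∑ i, d i * (x i ^ 2 - 1)))
        ∂(Measure.pi fun _ : Fin n => μ) ≤
      ENNReal.ofReal (Real.exp (200 * n * κ ^ 4 * L ^ 2 * l ^ 2)) := by
  have hk := h.pos
  have hθ : ∀ i, |l * d i| ≤ |l| * (2 * L) := fun i => by
    rw [abs_mul]; gcongr; exact hd i
  have key := lintegral_pi_exp_sum_le (ι := Fin n) μ (fun i y => l * d i * (y ^ 2 - 1))
    (fun i => by fun_prop) (fun i => 48 * κ ^ 4 * (l * d i) ^ 2)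
    fun i => h.lintegral_exp_mul_sq_sub_one_le (by
      have : |l * d i| * κ ^ 2 ≤ |l| * (2 * L) * κ ^ 2 := by gcongr; exact hθ i
      linarith)
  simp_rw [Finset.mul_sum, ← mul_assoc]
  refine key.trans (ENNReal.ofReal_le_ofReal (Real.exp_le_exp.2 ?_))
  calc _ ≤ ∑ i : Fin n, 200 * κ ^ 4 * L ^ 2 * l ^ 2 := by
        refine Finset.sum_le_sum fun i _ => ?_
        have : (l * d i) ^ 2 ≤ (|l| * (2 * L)) ^ 2 := sq_le_sq' (abs_le.1 (hθ i)).1 (abs_le.1 (hθ i)).2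
        rw [mul_pow |l|, sq_abs] at this
        calc _ ≤ 48 * κ ^ 4 * (l ^ 2 * (2 * L) ^ 2) := by gcongr
          _ = 192 * (κ ^ 4 * L ^ 2 * l ^ 2) := by ring
          _ ≤ 200 * (κ ^ 4 * L ^ 2 * l ^ 2) := by gcongr; norm_num
          _ = _ := by ring
    _ = _ := by simp; ring

/-! ### Off-diagonal part: decoupling -/

/-- Conditionally on the coordinates outside `I`, a bilinear form in the two blocks of coordinates
is a linear form in independent sub-Gaussian variables. -/
lemma lintegral_exp_block_le {μ : Measure ℝ} {κ : ℝ} [IsProbabilityMeasure μ]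
    (h : IsStdSubGaussian μ κ) {n : ℕ} (B : Matrix (Fin n) (Fin n) ℝ) (I : Finset (Fin n)) :
    ∫⁻ x, ENNReal.ofReal (Real.exp (∑ i ∈ I, x i * ∑ j ∈ Iᶜ, B i j * x j))
        ∂(Measure.pi fun _ : Fin n => μ) ≤
      ∫⁻ x, ENNReal.ofReal (Real.exp (8 * κ ^ 2 * ∑ i ∈ I, (∑ j ∈ Iᶜ, B i j * x j) ^ 2))
        ∂(Measure.pi fun _ : Fin n => μ) := by
  have hmp := measurePreserving_piEquivPiSubtypeProd (fun _ : Fin n => μ) (· ∈ I)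
  have hI : ∀ f : Fin n → ℝ, ∑ i ∈ I, f i = ∑ i : {i // i ∈ I}, f i := fun f =>
    Finset.sum_subtype I (fun _ => Iff.rfl) f
  have hIc : ∀ f : Fin n → ℝ, ∑ i ∈ Iᶜ, f i = ∑ i : {i // ¬ i ∈ I}, f i := fun f =>
    Finset.sum_subtype Iᶜ (fun _ => Finset.mem_compl) f
  simp_rw [hI, hIc]
  have e1 := hmp.lintegral_comp (f := fun z => ENNReal.ofReal (Real.exp
    (∑ i, z.1 i * ∑ j : {j // ¬ j ∈ I}, B i j * z.2 j))) (by fun_prop)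
  have e2 := hmp.lintegral_comp (f := fun z => ENNReal.ofReal (Real.exp
    (8 * κ ^ 2 * ∑ i : {i // i ∈ I}, (∑ j : {j // ¬ j ∈ I}, B i j * z.2 j) ^ 2))) (by fun_prop)
  refine (e1.trans_le ?_).trans e2.ge
  -- The outer integral runs over the coordinates outside `I`. On the right the integrand does not
  -- depend on the inner block.
  rw [lintegral_prod_symm _ (by fun_prop), lintegral_prod_symm _ (by fun_prop)]
  refine lintegral_mono fun v => ?_
  simp only [lintegral_const, measure_univ, mul_one, Finset.mul_sum (a := 8 * κ ^ 2)]
  rw [Subsingleton.elim (Finset.Subtype.fintype I) (Subtype.fintype (· ∈ I))]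
  refine @lintegral_pi_exp_sum_le {i // i ∈ I} (Subtype.fintype _) μ _ (fun i y =>
    y * ∑ j : {j // ¬ j ∈ I}, B i j * v j) (fun i => by fun_prop) _ fun i => ?_
  simp_rw [mul_comm _ (∑ j : {j // ¬ j ∈ I}, B i j * v j)]
  exact h.lintegral_exp_mul_le _

lemma lintegral_exp_scaled_block_le {μ : Measure ℝ} {κ : ℝ} [IsProbabilityMeasure μ]
    (h : IsStdSubGaussian μ κ) {n : ℕ} (A : Matrix (Fin n) (Fin n) ℝ) {L l : ℝ} (hL : 0 ≤ L)
    (hA : ∀ v : Fin n → ℝ, ∑ i, (A *ᵥ v) i ^ 2 ≤ L ^ 2 * ∑ i, v i ^ 2)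
    (hl : |l| * L * κ ^ 2 ≤ 1 / 16) (I : Finset (Fin n)) :
    ∫⁻ x, ENNReal.ofReal (Real.exp (4 * l * ∑ i ∈ I, ∑ j ∈ Iᶜ, A i j * x i * x j))
        ∂(Measure.pi fun _ : Fin n => μ) ≤
      ENNReal.ofReal (Real.exp (200 * n * κ ^ 4 * L ^ 2 * l ^ 2)) := by
  have hk := h.pos
  have e1 : ∀ x : Fin n → ℝ, 4 * l * ∑ i ∈ I, ∑ j ∈ Iᶜ, A i j * x i * x j =
      ∑ i ∈ I, x i * ∑ j ∈ Iᶜ, ((4 * l) • A) i j * x j := fun x => by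
    simp only [Finset.mul_sum, Matrix.smul_apply, smul_eq_mul]
    exact Finset.sum_congr rfl fun i _ => Finset.sum_congr rfl fun j _ => by ring
  simp_rw [e1]
  -- 128 = 8 · 4², from the sub-Gaussian exponent and the factor 4l. Then θκ² ≤ 128/16² = 1/2.
  set θ := 128 * κ ^ 2 * l ^ 2 * L ^ 2 with hθ
  have hsmall : θ * κ ^ 2 ≤ 1 := by
    have h1 : (|l| * L * κ ^ 2) ^ 2 ≤ (1 / 16) ^ 2 := by gcongr
    have h2 : (|l| * L * κ ^ 2) ^ 2 = l ^ 2 * L ^ 2 * κ ^ 4 := by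
      rw [mul_pow, mul_pow, sq_abs]; ring
    nlinarith
  have hpt : ∀ x : Fin n → ℝ,
      8 * κ ^ 2 * ∑ i ∈ I, (∑ j ∈ Iᶜ, ((4 * l) • A) i j * x j) ^ 2 ≤ ∑ i, θ * x i ^ 2 := fun x => by
    have h1 : ∑ i ∈ I, (∑ j ∈ Iᶜ, A i j * x j) ^ 2 ≤ L ^ 2 * ∑ i, x i ^ 2 := by
      calc ∑ i ∈ I, (∑ j ∈ Iᶜ, A i j * x j) ^ 2
          ≤ ∑ i, (∑ j ∈ Iᶜ, A i j * x j) ^ 2 :=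
            Finset.sum_le_univ_sum_of_nonneg fun i => sq_nonneg _
        -- Zeroing the coordinates in `I` exhibits the block sum as `A` applied to a vector, so the
        -- operator norm bound applies.
        _ = ∑ i, (A *ᵥ fun j => if j ∈ Iᶜ then x j else 0) i ^ 2 := by
            refine Finset.sum_congr rfl fun i _ => ?_
            simp only [Matrix.mulVec, dotProduct, mul_ite, mul_zero, Finset.sum_ite_mem,
              Finset.univ_inter]
        _ ≤ L ^ 2 * ∑ j, (if j ∈ Iᶜ then x j else 0) ^ 2 := hA _
        _ ≤ _ := by
            refine mul_le_mul_of_nonneg_left (Finset.sum_le_sum fun j _ => ?_) (sq_nonneg L)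
            split_ifs
            · exact le_rfl
            · simpa using sq_nonneg (x j)
    calc _ = 128 * κ ^ 2 * l ^ 2 * ∑ i ∈ I, (∑ j ∈ Iᶜ, A i j * x j) ^ 2 := by
          simp only [Matrix.smul_apply, smul_eq_mul, mul_assoc (4 * l), ← Finset.mul_sum, mul_pow]
          ring
      _ ≤ 128 * κ ^ 2 * l ^ 2 * (L ^ 2 * ∑ i, x i ^ 2) := by gcongr
      _ = _ := by rw [← Finset.mul_sum]; ring
  calc _ ≤ _ := lintegral_exp_block_le h _ I
    _ ≤ ∫⁻ x, ENNReal.ofReal (Real.exp (∑ i, θ * x i ^ 2)) ∂(Measure.pi fun _ : Fin n => μ) :=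
        lintegral_mono fun x => ENNReal.ofReal_le_ofReal (Real.exp_le_exp.2 (hpt x))
    _ ≤ ENNReal.ofReal (Real.exp (∑ _i : Fin n, θ * κ ^ 2)) :=
        lintegral_pi_exp_sum_le μ (fun _ y => θ * y ^ 2) (fun i => by fun_prop) _
          fun i => h.lintegral_exp_mul_sq_le (by positivity) hsmall
    _ ≤ _ := by
        apply ENNReal.ofReal_le_ofReal
        apply Real.exp_le_exp.2
        simp only [Finset.sum_const, Finset.card_univ, Fintype.card_fin, nsmul_eq_mul]
        calc _ = 128 * (n * κ ^ 4 * L ^ 2 * l ^ 2) := by rw [hθ]; ring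
          _ ≤ 200 * (n * κ ^ 4 * L ^ 2 * l ^ 2) := by gcongr; norm_num
          _ = _ := by ring

/-- A quarter of the 2ⁿ subsets contain i and omit j, as toggling the membership of i and then of j
shows. -/
lemma sum_finset_mem_not_mem {n : ℕ} {i j : Fin n} (hij : i ≠ j) :
    ∑ I : Finset (Fin n), (if i ∈ I ∧ j ∉ I then (4 : ℝ) else 0) = 2 ^ n := by
  have toggle : ∀ (k : Fin n) (f : Finset (Fin n) → ℝ),
      ∑ I, f (symmDiff I {k}) = ∑ I, f I := fun k f =>
    Equiv.sum_comp (Function.Involutive.toPerm (fun I : Finset (Fin n) => symmDiff I {k})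
      fun I => by simp) f
  have h1 := toggle i (fun I => if i ∈ I ∧ j ∉ I then (4 : ℝ) else 0)
  have h2 := toggle j (fun I => if j ∉ I then (2 : ℝ) else 0)
  have h3 : ∑ I : Finset (Fin n), (if i ∈ I ∧ j ∉ I then (4 : ℝ) else 0) +
      ∑ I : Finset (Fin n), (if i ∈ symmDiff I {i} ∧ j ∉ symmDiff I {i} then (4 : ℝ) else 0) =
      2 * ∑ I : Finset (Fin n), (if j ∉ I then (2 : ℝ) else 0) := by
    rw [← Finset.sum_add_distrib, Finset.mul_sum]
    refine Finset.sum_congr rfl fun I _ => ?_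
    have := hij.symm
    by_cases hi : i ∈ I <;> by_cases hj : j ∈ I <;> simp [Finset.mem_symmDiff, hi, hj, this] <;>
      norm_num
  have h4 : ∑ I : Finset (Fin n), (if j ∉ I then (2 : ℝ) else 0) +
      ∑ I : Finset (Fin n), (if j ∉ symmDiff I {j} then (2 : ℝ) else 0) =
      ∑ I : Finset (Fin n), (2 : ℝ) := by
    rw [← Finset.sum_add_distrib]
    refine Finset.sum_congr rfl fun I _ => ?_
    by_cases hj : j ∈ I <;> simp [Finset.mem_symmDiff, hj]
  simp only [Finset.sum_const, Finset.card_univ, Fintype.card_finset, Fintype.card_fin,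
    nsmul_eq_mul, Nat.cast_pow, Nat.cast_ofNat] at h4
  linarith

/-- The off-diagonal part of a quadratic form is an average of block bilinear forms. -/
lemma offDiagonal_eq_average {n : ℕ} (A : Matrix (Fin n) (Fin n) ℝ) (x : Fin n → ℝ) :
    ∑ i, ∑ j, (if i = j then 0 else A i j * x i * x j) =
      ∑ I : Finset (Fin n), (1 / 2 ^ n : ℝ) * (4 * ∑ i ∈ I, ∑ j ∈ Iᶜ, A i j * x i * x j) := by
  have h1 : ∀ I : Finset (Fin n), 4 * ∑ i ∈ I, ∑ j ∈ Iᶜ, A i j * x i * x j =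
      ∑ i, ∑ j, (if i ∈ I ∧ j ∉ I then (4 : ℝ) else 0) * (A i j * x i * x j) := fun I => by
    rw [← Finset.sum_subset (Finset.subset_univ I), Finset.mul_sum]
    · refine Finset.sum_congr rfl fun i hi => ?_
      rw [← Finset.sum_subset (Finset.subset_univ Iᶜ), Finset.mul_sum]
      · refine Finset.sum_congr rfl fun j hj => ?_
        simp [hi, Finset.mem_compl.1 hj]
      · intro j _ hj
        simp_all
    · intro i _ hi
      simp [hi]
  simp_rw [h1]
  rw [← Finset.mul_sum, Finset.sum_comm (s := (Finset.univ : Finset (Finset (Fin n)))),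
    Finset.mul_sum]
  refine Finset.sum_congr rfl fun i _ => ?_
  rw [Finset.sum_comm, Finset.mul_sum]
  refine Finset.sum_congr rfl fun j _ => ?_
  rw [← Finset.sum_mul]
  split_ifs with hij
  · subst hij; simp
  · rw [sum_finset_mem_not_mem hij]; field_simp

/-- Jensen's inequality for exp moves the average over `I` outside, and every block obeys the same
bound. -/
lemma lintegral_exp_offDiagonal_le {μ : Measure ℝ} {κ : ℝ} [IsProbabilityMeasure μ]
    (h : IsStdSubGaussian μ κ) {n : ℕ} (A : Matrix (Fin n) (Fin n) ℝ) {L l : ℝ} (hL : 0 ≤ L)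
    (hA : ∀ v : Fin n → ℝ, ∑ i, (A *ᵥ v) i ^ 2 ≤ L ^ 2 * ∑ i, v i ^ 2)
    (hl : |l| * L * κ ^ 2 ≤ 1 / 16) :
    ∫⁻ x, ENNReal.ofReal (Real.exp (l * ∑ i, ∑ j, (if i = j then 0 else A i j * x i * x j)))
        ∂(Measure.pi fun _ : Fin n => μ) ≤
      ENNReal.ofReal (Real.exp (200 * n * κ ^ 4 * L ^ 2 * l ^ 2)) := by
  have hw : ∑ _I : Finset (Fin n), (1 / 2 ^ n : ℝ) = 1 := by simp
  have hpt : ∀ x : Fin n → ℝ,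
      ENNReal.ofReal (Real.exp (l * ∑ i, ∑ j, (if i = j then 0 else A i j * x i * x j))) ≤
      ∑ I : Finset (Fin n), ENNReal.ofReal (1 / 2 ^ n : ℝ) *
        ENNReal.ofReal (Real.exp (4 * l * ∑ i ∈ I, ∑ j ∈ Iᶜ, A i j * x i * x j)) := fun x => by
    simp_rw [← ENNReal.ofReal_mul (show (0 : ℝ) ≤ 1 / 2 ^ n by positivity)]
    rw [← ENNReal.ofReal_sum_of_nonneg fun I _ => by positivity]
    apply ENNReal.ofReal_le_ofReal
    have := convexOn_exp.map_sum_le (t := Finset.univ) (w := fun _ : Finset (Fin n) => (1 / 2 ^ n : ℝ))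
      (p := fun I => 4 * l * ∑ i ∈ I, ∑ j ∈ Iᶜ, A i j * x i * x j)
      (fun _ _ => by positivity) hw (fun _ _ => Set.mem_univ _)
    simp only [smul_eq_mul] at this
    refine le_of_eq_of_le ?_ this
    rw [offDiagonal_eq_average, Finset.mul_sum]
    congr 1
    exact Finset.sum_congr rfl fun I _ => by ring
  calc _ ≤ _ := lintegral_mono hpt
    _ = ∑ I : Finset (Fin n), ENNReal.ofReal (1 / 2 ^ n : ℝ) *
        ∫⁻ x, ENNReal.ofReal (Real.exp (4 * l * ∑ i ∈ I, ∑ j ∈ Iᶜ, A i j * x i * x j))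
          ∂(Measure.pi fun _ : Fin n => μ) := by
        rw [lintegral_finsetSum _ fun I _ => by fun_prop]
        exact Finset.sum_congr rfl fun I _ => lintegral_const_mul _ (by fun_prop)
    _ ≤ ∑ I : Finset (Fin n), ENNReal.ofReal (1 / 2 ^ n : ℝ) *
        ENNReal.ofReal (Real.exp (200 * n * κ ^ 4 * L ^ 2 * l ^ 2)) := by
        gcongr with I
        exact lintegral_exp_scaled_block_le h A hL hA hl I
    _ = _ := by
        rw [← Finset.sum_mul, ← ENNReal.ofReal_sum_of_nonneg fun I _ => by positivity, hw]
        simp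

/-! ### Chernoff bound -/

lemma measureReal_ge_le_of_lintegral_exp_le {Ω : Type*} [MeasurableSpace Ω] {P : Measure Ω}
    [IsProbabilityMeasure P] {S : Ω → ℝ} (hS : Measurable S) {b : ℝ} (u : ℝ)
    (h : ∫⁻ ω, ENNReal.ofReal (Real.exp (S ω)) ∂P ≤ ENNReal.ofReal (Real.exp b)) :
    P.real {ω | u ≤ S ω} ≤ Real.exp (b - u) := by
  have h1 := (mul_meas_ge_le_lintegral (μ := P) (f := fun ω => ENNReal.ofReal (Real.exp (S ω)))
    (by fun_prop) (ENNReal.ofReal (Real.exp u))).trans h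
  have hset : {ω | ENNReal.ofReal (Real.exp u) ≤ ENNReal.ofReal (Real.exp (S ω))} =
      {ω | u ≤ S ω} := by
    ext ω
    simp [ENNReal.ofReal_le_ofReal_iff (Real.exp_pos _).le]
  rw [hset, ← ofReal_measureReal, ← ENNReal.ofReal_mul (Real.exp_pos _).le,
    ENNReal.ofReal_le_ofReal_iff (Real.exp_pos _).le] at h1
  rw [Real.exp_sub, le_div_iff₀ (Real.exp_pos _)]
  linarith

/-- The Chernoff bound in the regime where the moment generating function is Gaussian. -/
lemma measureReal_abs_ge_le_of_mgf {Ω : Type*} [MeasurableSpace Ω] {P : Measure Ω}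
    [IsProbabilityMeasure P] {S : Ω → ℝ} (hS : Measurable S) {n κ L s : ℝ} (hκ : 1 ≤ κ)
    (hL : 0 < L) (hs0 : 0 ≤ s) (hs1 : s ≤ 1)
    (h : ∀ l, |l| * L * κ ^ 2 ≤ 1 / 16 → ∫⁻ ω, ENNReal.ofReal (Real.exp (l * S ω)) ∂P ≤
      ENNReal.ofReal (Real.exp (200 * n * κ ^ 4 * L ^ 2 * l ^ 2))) :
    P.real {ω | n * s * L ≤ |S ω|} ≤ 2 * Real.exp (-(n * s ^ 2 / (800 * κ ^ 4))) := by
  -- The minimizer of 200nκ⁴L²l² − l · nsL. It is admissible because s ≤ 1 ≤ κ.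
  set l := s / (400 * κ ^ 4 * L) with hl
  have hl0 : 0 ≤ l := by positivity
  have hsmall : l * L * κ ^ 2 ≤ 1 / 16 := by
    have : l * L * κ ^ 2 = s / (400 * κ ^ 2) := by rw [hl]; field_simp
    rw [this, div_le_div_iff₀ (by positivity) (by norm_num)]
    nlinarith [one_le_pow₀ hκ (n := 2)]
  have hexp : 200 * n * κ ^ 4 * L ^ 2 * l ^ 2 - l * (n * s * L) =
      -(n * s ^ 2 / (800 * κ ^ 4)) := by
    rw [hl]; field_simp; ring
  have h1 := measureReal_ge_le_of_lintegral_exp_le (P := P) (S := fun ω => l * S ω) (by fun_prop)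
    (l * (n * s * L)) (h l (by rwa [abs_of_nonneg hl0]))
  have h2 := measureReal_ge_le_of_lintegral_exp_le (P := P) (S := fun ω => -l * S ω) (by fun_prop)
    (l * (n * s * L)) (h (-l) (by rwa [abs_neg, abs_of_nonneg hl0]))
  rw [neg_sq, hexp] at h2
  rw [hexp] at h1
  calc P.real {ω | n * s * L ≤ |S ω|}
      ≤ P.real ({ω | l * (n * s * L) ≤ l * S ω} ∪ {ω | l * (n * s * L) ≤ -l * S ω}) := by
        refine measureReal_mono fun ω hω => ?_
        simp only [Set.mem_ofPred_eq, le_abs, Set.mem_union] at hω ⊢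
        refine hω.imp (fun h => by gcongr) fun h => ?_
        rw [neg_mul, ← mul_neg]; gcongr
    _ ≤ _ := measureReal_union_le _ _
    _ ≤ _ := by linarith

/-! ### Deterministic bounds on quadratic forms -/

lemma sum_mulVec_sq_le {n : ℕ} (A : Matrix (Fin n) (Fin n) ℝ) (v : Fin n → ℝ) :
    ∑ i, (A *ᵥ v) i ^ 2 ≤ matrixOpNorm A ^ 2 * ∑ i, v i ^ 2 := by
  have h := (Matrix.toEuclideanCLM (n := Fin n) (𝕜 := ℝ) A).le_opNorm (WithLp.toLp 2 v)
  have h2 : ‖Matrix.toEuclideanCLM (n := Fin n) (𝕜 := ℝ) A (WithLp.toLp 2 v)‖ ^ 2 ≤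
      (matrixOpNorm A * ‖WithLp.toLp 2 v‖) ^ 2 := by gcongr; exact h
  rw [mul_pow, EuclideanSpace.norm_sq_eq, EuclideanSpace.norm_sq_eq] at h2
  simpa using h2

lemma matrixOpNorm_pos {n : ℕ} {A : Matrix (Fin n) (Fin n) ℝ} (hA : A ≠ 0) :
    0 < matrixOpNorm A :=
  norm_pos_iff.2 fun h => hA ((map_eq_zero_iff _
    (Matrix.toEuclideanCLM (n := Fin n) (𝕜 := ℝ)).injective).1 h)

lemma abs_apply_le_matrixOpNorm {n : ℕ} (A : Matrix (Fin n) (Fin n) ℝ) (i j : Fin n) :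
    |A i j| ≤ matrixOpNorm A := by
  have h := sum_mulVec_sq_le A (Pi.single j 1)
  have h1 : (A *ᵥ Pi.single j 1) i ^ 2 ≤ ∑ i, (A *ᵥ Pi.single j 1) i ^ 2 :=
    Finset.single_le_sum (f := fun i => (A *ᵥ Pi.single j 1) i ^ 2)
      (fun _ _ => sq_nonneg _) (Finset.mem_univ i)
  have h2 : ∑ k, (Pi.single j (1 : ℝ) : Fin n → ℝ) k ^ 2 = 1 := by
    simp [Pi.single_apply]
  rw [h2, mul_one] at h
  simp only [Matrix.mulVec_single_one, Matrix.col_apply] at h1 h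
  exact abs_le_of_sq_le_sq (h1.trans h) (norm_nonneg _)

lemma abs_quadForm_le {n : ℕ} (A : Matrix (Fin n) (Fin n) ℝ) (y : Fin n → ℝ) :
    |quadForm A y| ≤ matrixOpNorm A * ∑ i, y i ^ 2 := by
  have hL : 0 ≤ matrixOpNorm A := norm_nonneg _
  have hy : 0 ≤ ∑ i, y i ^ 2 := Finset.sum_nonneg fun _ _ => sq_nonneg _
  refine abs_le_of_sq_le_sq ?_ (by positivity)
  calc (∑ i, y i * (A *ᵥ y) i) ^ 2 ≤ (∑ i, y i ^ 2) * ∑ i, (A *ᵥ y) i ^ 2 :=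
        Finset.sum_mul_sq_le_sq_mul_sq _ _ _
    _ ≤ (∑ i, y i ^ 2) * (matrixOpNorm A ^ 2 * ∑ i, y i ^ 2) := by
        gcongr; exact sum_mulVec_sq_le A y
    _ = _ := by ring

lemma sum_selfNormalize_sq_le {n : ℕ} (x : Fin n → ℝ) : ∑ i, selfNormalize x i ^ 2 ≤ 1 := by
  simp only [selfNormalize, div_pow, ← Finset.sum_div]
  rw [Real.sq_sqrt (Finset.sum_nonneg fun _ _ => sq_nonneg _)]
  exact div_self_le_one _

lemma quadForm_selfNormalize {n : ℕ} (A : Matrix (Fin n) (Fin n) ℝ) (x : Fin n → ℝ) :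
    quadForm A (selfNormalize x) = quadForm A x / ∑ j, x j ^ 2 := by
  have h : selfNormalize x = (√(∑ j, x j ^ 2))⁻¹ • x := by
    ext i; simp [selfNormalize, div_eq_inv_mul]
  rw [h, quadForm, Matrix.mulVec_smul, smul_dotProduct, dotProduct_smul, smul_smul, ← mul_inv,
    Real.mul_self_sqrt (Finset.sum_nonneg fun _ _ => sq_nonneg _), smul_eq_mul, ← quadForm]
  ring

lemma abs_quadForm_selfNormalize_le {n : ℕ} (A : Matrix (Fin n) (Fin n) ℝ) (x : Fin n → ℝ) :
    |quadForm A (selfNormalize x)| ≤ matrixOpNorm A :=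
  (abs_quadForm_le A _).trans
    (mul_le_of_le_one_right (norm_nonneg _) (sum_selfNormalize_sq_le x))

lemma abs_trace_div_le {n : ℕ} (hn : 1 ≤ n) (A : Matrix (Fin n) (Fin n) ℝ) :
    |A.trace / n| ≤ matrixOpNorm A := by
  have hn' : (0 : ℝ) < n := by exact_mod_cast hn
  rw [abs_div, abs_of_pos hn', div_le_iff₀ hn']
  calc |A.trace| ≤ ∑ i, |A i i| := Finset.abs_sum_le_sum_abs _ _
    _ ≤ ∑ _i : Fin n, matrixOpNorm A := Finset.sum_le_sum fun i _ => abs_apply_le_matrixOpNorm A i i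
    _ = _ := by simp [mul_comm]

/-- Replacing x i ² by x i ² − 1 costs nothing because the coefficients A i i − tr A/n sum to zero.
-/
lemma quadForm_sub_trace {n : ℕ} (hn : 1 ≤ n) (A : Matrix (Fin n) (Fin n) ℝ) (x : Fin n → ℝ) :
    quadForm A x - A.trace / n * ∑ i, x i ^ 2 =
      ∑ i, (A i i - A.trace / n) * (x i ^ 2 - 1) +
      ∑ i, ∑ j, (if i = j then 0 else A i j * x i * x j) := by
  have hn' : (n : ℝ) ≠ 0 := by positivity
  have h1 : quadForm A x = ∑ i, A i i * x i ^ 2 +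
      ∑ i, ∑ j, (if i = j then 0 else A i j * x i * x j) := by
    simp only [quadForm, dotProduct, Matrix.mulVec]
    rw [← Finset.sum_add_distrib]
    refine Finset.sum_congr rfl fun i _ => ?_
    have : A i i * x i ^ 2 = ∑ j, if i = j then A i j * x i * x j else 0 := by
      rw [Finset.sum_ite_eq]; simp; ring
    rw [this, ← Finset.sum_add_distrib, Finset.mul_sum]
    refine Finset.sum_congr rfl fun j _ => ?_
    split_ifs <;> ring
  have h2 : ∑ i, (A i i - A.trace / n) * (x i ^ 2 - 1) =
      ∑ i, A i i * x i ^ 2 - A.trace / n * ∑ i, x i ^ 2 - (A.trace - ∑ _i : Fin n, A.trace / n) := by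
    rw [Matrix.trace, Finset.mul_sum, ← Finset.sum_sub_distrib, ← Finset.sum_sub_distrib,
      ← Finset.sum_sub_distrib]
    exact Finset.sum_congr rfl fun i _ => by simp only [Matrix.diag_apply]; ring
  rw [h2, h1]
  simp only [Finset.sum_const, Finset.card_univ, Fintype.card_fin, nsmul_eq_mul]
  field_simp
  ring

/-! ### Concentration around the normalized trace and around the mean -/

/-- Concentration of the self-normalized form around the normalized trace. -/
lemma measureReal_abs_quadForm_sub_trace_ge_le {μ : Measure ℝ} {κ : ℝ} [IsProbabilityMeasure μ]
    (h : IsStdSubGaussian μ κ) {n : ℕ} (hn : 1 ≤ n) {A : Matrix (Fin n) (Fin n) ℝ} (hA : A ≠ 0)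
    {t : ℝ} (ht : 0 < t) :
    (Measure.pi fun _ : Fin n => μ).real
        {x | t ≤ |quadForm A (selfNormalize x) - A.trace / n|} ≤
      6 * Real.exp (-(n / (12800 * κ ^ 4 * matrixOpNorm A ^ 2) * t ^ 2)) := by
  set Q := Measure.pi fun _ : Fin n => μ
  set L := matrixOpNorm A with hLdef
  have hL : 0 < L := matrixOpNorm_pos hA
  have hn' : (1 : ℝ) ≤ n := by exact_mod_cast hn
  have hκ := h.one_le
  obtain hbig | hsmall := lt_or_ge (2 * L) t
  · have : {x : Fin n → ℝ | t ≤ |quadForm A (selfNormalize x) - A.trace / n|} = ∅ := by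
      refine Set.eq_empty_of_forall_notMem fun x hx => ?_
      have h1 := abs_sub (quadForm A (selfNormalize x)) (A.trace / n)
      have h2 := abs_quadForm_selfNormalize_le A x
      have h3 := abs_trace_div_le hn A
      simp only [Set.mem_ofPred_eq] at hx
      linarith
    rw [this, measureReal_empty]
    positivity
  -- Each part of the numerator stays below nsL = nt/4, so their sum is below nt/2. As s ≤ 1/2, the
  -- denominator exceeds n/2, and the quotient is below t.
  set s := t / (4 * L) with hs
  have hs0 : 0 < s := by positivity
  have hs1 : s ≤ 1 / 2 := by rw [hs, div_le_iff₀ (by positivity)]; linarith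
  have htr := abs_trace_div_le hn A
  have b1 := measureReal_abs_ge_le_of_mgf (P := Q) (n := n) (κ := κ) (L := L) (s := s)
    (S := fun x => ∑ i, (A i i - A.trace / n) * (x i ^ 2 - 1)) (by fun_prop) hκ hL hs0.le
    (by linarith) fun l hl => lintegral_exp_diagonal_le h _ (fun i => by
      have h1 := abs_sub (A i i) (A.trace / n)
      linarith [abs_apply_le_matrixOpNorm A i i]) hl
  have b2 := measureReal_abs_ge_le_of_mgf (P := Q) (n := n) (κ := κ) (L := L) (s := s)
    (S := fun x => ∑ i, ∑ j, (if i = j then 0 else A i j * x i * x j))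
    (Finset.measurable_sum _ fun i _ => Finset.measurable_sum _ fun j _ => by
      split_ifs <;> fun_prop) hκ hL hs0.le
    (by linarith) fun l hl => lintegral_exp_offDiagonal_le h A hL.le (sum_mulVec_sq_le A) hl
  -- Unit coefficients give the concentration of ‖x‖² around n.
  have b3 := measureReal_abs_ge_le_of_mgf (P := Q) (n := n) (κ := κ) (L := 1) (s := s)
    (S := fun x => ∑ i, (1 : ℝ) * (x i ^ 2 - 1)) (by fun_prop) hκ one_pos hs0.le
    (by linarith) fun l hl => lintegral_exp_diagonal_le h _ (fun i => by norm_num) hl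
  have hexp : n * s ^ 2 / (800 * κ ^ 4) = n / (12800 * κ ^ 4 * L ^ 2) * t ^ 2 := by
    rw [hs]; field_simp; norm_num
  rw [hexp] at b1 b2 b3
  refine (measureReal_mono (s₂ := ({x | n * s * L ≤ |∑ i, (A i i - A.trace / n) * (x i ^ 2 - 1)|} ∪
    {x | n * s * L ≤ |∑ i, ∑ j, (if i = j then 0 else A i j * x i * x j)|}) ∪
    {x | n * s * 1 ≤ |∑ i, (1 : ℝ) * (x i ^ 2 - 1)|}) fun x hx => ?_).trans ?_
  · by_contra hc
    simp only [Set.mem_union, Set.mem_ofPred_eq, not_or, not_le, one_mul, mul_one,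
      Finset.sum_sub_distrib, Finset.sum_const, Finset.card_univ, Fintype.card_fin,
      nsmul_eq_mul] at hc hx
    obtain ⟨⟨c1, c2⟩, c3⟩ := hc
    set N := ∑ i, x i ^ 2 with hN
    have hN2 : n / 2 < N := by
      have := (abs_lt.1 c3).1
      nlinarith
    have hN0 : 0 < N := by linarith
    have e := quadForm_sub_trace hn A x
    have hsL : s * L = t / 4 := by rw [hs]; field_simp
    have h3 : |quadForm A x - A.trace / n * N| < n * t / 2 := by
      rw [hN, e]
      refine (abs_add_le _ _).trans_lt ?_
      rw [mul_assoc, hsL] at c1 c2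
      linarith
    rw [quadForm_selfNormalize, ← hN, div_sub' hN0.ne', abs_div, abs_of_pos hN0,
      le_div_iff₀ hN0, mul_comm N] at hx
    nlinarith
  · refine (measureReal_union_le _ _).trans ?_
    have := measureReal_union_le (μ := Q)
      {x | n * s * L ≤ |∑ i, (A i i - A.trace / n) * (x i ^ 2 - 1)|}
      {x | n * s * L ≤ |∑ i, ∑ j, (if i = j then 0 else A i j * x i * x j)|}
    linarith

/-- Sub-Gaussian concentration around some point implies concentration around the mean. -/
lemma measureReal_abs_sub_integral_ge_le {Ω : Type*} [MeasurableSpace Ω] {P : Measure Ω}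
    [IsProbabilityMeasure P] {Z : Ω → ℝ} (hZ : Integrable Z P) {m b : ℝ} (hb : 0 < b)
    (h : ∀ t : ℝ, 0 < t → P.real {ω | t ≤ |Z ω - m|} ≤ 6 * Real.exp (-(b * t ^ 2)))
    {t : ℝ} (ht : 0 < t) :
    P.real {ω | t ≤ |Z ω - ∫ ω', Z ω' ∂P|} ≤ 6 * Real.exp 36 * Real.exp (-(b / 4 * t ^ 2)) := by
  have hZm : Integrable (fun ω => |Z ω - m|) P := (hZ.sub (integrable_const m)).abs
  have hmean : |(∫ ω, Z ω ∂P) - m| ≤ 3 * √(Real.pi / b) := by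
    have e1 : (∫ ω, Z ω ∂P) - m = ∫ ω, (Z ω - m) ∂P := by
      rw [integral_sub hZ (integrable_const m)]; simp
    have hg := integrable_exp_neg_mul_sq hb
    calc |(∫ ω, Z ω ∂P) - m| ≤ ∫ ω, |Z ω - m| ∂P := by
          rw [e1]; exact abs_integral_le_integral_abs
      _ = ∫ t in Set.Ioi 0, P.real {ω | t ≤ |Z ω - m|} :=
          hZm.integral_eq_integral_meas_le (.of_forall fun _ => abs_nonneg _)
      _ ≤ ∫ t in Set.Ioi 0, 6 * Real.exp (-b * t ^ 2) := by
          refine integral_mono_of_nonneg (.of_forall fun _ => measureReal_nonneg)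
            (hg.const_mul 6).integrableOn ?_
          filter_upwards [self_mem_ae_restrict measurableSet_Ioi] with t ht
          simpa [neg_mul] using h t ht
      _ = _ := by rw [integral_const_mul, integral_gaussian_Ioi]; ring
  -- Below twice the displacement of the mean, bt²/4 ≤ 9π ≤ 36, so the factor exp 36 makes the bound
  -- trivial. Above it, moving the center costs at most t/2.
  obtain hlt | hge := lt_or_ge t (2 * (3 * √(Real.pi / b)))
  · have h1 : t ^ 2 ≤ 36 * (Real.pi / b) := by
      have : t ^ 2 ≤ (2 * (3 * √(Real.pi / b))) ^ 2 := by gcongr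
      rw [mul_pow, mul_pow, Real.sq_sqrt (by positivity)] at this
      linarith
    have h2 : b / 4 * t ^ 2 ≤ 36 := by
      calc b / 4 * t ^ 2 ≤ b / 4 * (36 * (Real.pi / b)) := by gcongr
        _ = 9 * Real.pi := by field_simp; norm_num
        _ ≤ 36 := by linarith [Real.pi_le_four]
    calc _ ≤ (1 : ℝ) := measureReal_le_one
      _ ≤ 6 * Real.exp (36 + -(b / 4 * t ^ 2)) := by
          linarith [Real.one_le_exp (show 0 ≤ 36 + -(b / 4 * t ^ 2) by linarith)]
      _ = _ := by rw [Real.exp_add]; ring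
  · calc _ ≤ P.real {ω | t / 2 ≤ |Z ω - m|} := by
          refine measureReal_mono fun ω hω => ?_
          simp only [Set.mem_ofPred_eq] at hω ⊢
          have := abs_sub_le (Z ω) m (∫ ω, Z ω ∂P)
          rw [abs_sub_comm m] at this
          linarith
      _ ≤ 6 * Real.exp (-(b * (t / 2) ^ 2)) := h _ (by positivity)
      _ = 6 * 1 * Real.exp (-(b / 4 * t ^ 2)) := by ring_nf
      _ ≤ _ := by gcongr; exact Real.one_le_exp (by norm_num)

/-! ### Standardization of ξ -/

lemma lintegral_exp_sq_div_le_two {Ω : Type*} [MeasurableSpace Ω] {P : Measure Ω}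
    [IsProbabilityMeasure P] {Z : Ω → ℝ} {ν : ℝ}
    (h : ∫⁻ ω, ENNReal.ofReal (psiTwo (|Z ω| / ν)) ∂P ≤ 1) :
    ∫⁻ ω, ENNReal.ofReal (Real.exp (Z ω ^ 2 / ν ^ 2)) ∂P ≤ 2 := by
  have hpt : ∀ ω, ENNReal.ofReal (Real.exp (Z ω ^ 2 / ν ^ 2)) =
      ENNReal.ofReal (psiTwo (|Z ω| / ν)) + 1 := fun ω => by
    have h0 : 0 ≤ psiTwo (|Z ω| / ν) := by
      rw [psiTwo, sub_nonneg]; exact Real.one_le_exp (sq_nonneg _)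
    rw [← ENNReal.ofReal_one, ← ENNReal.ofReal_add h0 zero_le_one, psiTwo, div_pow, sq_abs,
      sub_add_cancel]
  simp_rw [hpt]
  rw [lintegral_add_right _ measurable_const]
  calc _ ≤ (1 : ℝ≥0∞) + 1 := by gcongr; simp
    _ = 2 := one_add_one_eq_two

lemma memLp_two_of_lintegral_exp_sq_le {Ω : Type*} [MeasurableSpace Ω] {P : Measure Ω}
    {Z : Ω → ℝ} (hZ : AEMeasurable Z P) {ν : ℝ} (hν : 0 < ν)
    (h : ∫⁻ ω, ENNReal.ofReal (Real.exp (Z ω ^ 2 / ν ^ 2)) ∂P ≤ 2) : MemLp Z 2 P := by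
  have hi : Integrable (fun ω => Real.exp (Z ω ^ 2 / ν ^ 2)) P := by
    refine ⟨by fun_prop, ?_⟩
    rw [hasFiniteIntegral_iff_ofReal (.of_forall fun x => (Real.exp_pos _).le)]
    exact h.trans_lt (by simp)
  rw [memLp_two_iff_integrable_sq hZ.aestronglyMeasurable]
  refine (hi.const_mul (ν ^ 2)).mono' (by fun_prop) (.of_forall fun ω => ?_)
  rw [Real.norm_of_nonneg (sq_nonneg _), ← div_le_iff₀' (by positivity)]
  linarith [Real.add_one_le_exp (Z ω ^ 2 / ν ^ 2)]

lemma IsNondegenerate.variance_pos {Ω : Type*} [MeasurableSpace Ω] {P : Measure Ω}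
    [IsProbabilityMeasure P] {Z : Ω → ℝ} (h : IsNondegenerate Z P) (hZ : MemLp Z 2 P) :
    0 < Var[Z; P] := by
  refine (variance_nonneg Z P).lt_of_ne' fun h0 => h (P[Z]) ?_
  rw [Measure.map_congr (ae_eq_integral_of_variance_eq_zero hZ h0), Measure.map_const]
  simp

lemma isStdSubGaussian_map_div {Ω : Type*} [MeasurableSpace Ω] {P : Measure Ω}
    [IsProbabilityMeasure P] {Z : Ω → ℝ} (hZ : AEMeasurable Z P) (hmean : P[Z] = 0)
    (hvar : 0 < Var[Z; P]) {ν : ℝ} (hν : 0 < ν)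
    (h : ∫⁻ ω, ENNReal.ofReal (Real.exp (Z ω ^ 2 / ν ^ 2)) ∂P ≤ 2) :
    IsStdSubGaussian (P.map fun ω => Z ω / √(Var[Z; P])) (ν / √(Var[Z; P])) := by
  have hσ : 0 < √(Var[Z; P]) := Real.sqrt_pos.2 hvar
  have hm : AEMeasurable (fun ω => Z ω / √(Var[Z; P])) P := hZ.div_const _
  refine ⟨by positivity, ?_, ?_, ?_⟩
  · rw [integral_map hm (by fun_prop), integral_div, hmean, zero_div]
  · rw [integral_map hm (by fun_prop)]
    simp_rw [div_pow, Real.sq_sqrt hvar.le]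
    rw [integral_div, ← variance_of_integral_eq_zero hZ hmean, div_self hvar.ne']
  · rw [lintegral_map' (by fun_prop) hm]
    convert h using 4 with ω
    rw [div_pow, div_pow, div_div_div_cancel_right₀ (by positivity)]

/-- The factor 2 avoids having to show that the infimum defining the norm is attained: some
admissible ν lies below twice the norm. -/
lemma exists_isStdSubGaussian_map_div {Ω : Type*} [MeasurableSpace Ω] {P : Measure Ω}
    [IsProbabilityMeasure P] {Z : Ω → ℝ} (hZ : AEMeasurable Z P) (hmean : P[Z] = 0)
    (hnd : IsNondegenerate Z P) (hsub : IsSubGaussian Z P) :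
    0 < Var[Z; P] ∧ ∃ κ ≤ 2 * subGaussianRatio Z P,
      IsStdSubGaussian (P.map fun ω => Z ω / √(Var[Z; P])) κ := by
  have hvar : 0 < Var[Z; P] := by
    obtain ⟨ν, hν⟩ := iInf_lt_iff.1 hsub
    obtain ⟨⟨hν0, hν1⟩, -⟩ := iInf_lt_iff.1 hν
    exact hnd.variance_pos (memLp_two_of_lintegral_exp_sq_le hZ (NNReal.coe_pos.2 hν0)
      (lintegral_exp_sq_div_le_two hν1))
  refine ⟨hvar, ?_⟩
  have hσ : 0 < √(Var[Z; P]) := Real.sqrt_pos.2 hvar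
  have hprob : IsProbabilityMeasure (P.map fun ω => Z ω / √(Var[Z; P])) :=
    Measure.isProbabilityMeasure_map (hZ.div_const _)
  have hstd : ∀ ν : ℝ≥0, 0 < ν → ∫⁻ ω, ENNReal.ofReal (psiTwo (|Z ω| / ν)) ∂P ≤ 1 →
      IsStdSubGaussian (P.map fun ω => Z ω / √(Var[Z; P])) (ν / √(Var[Z; P])) :=
    fun ν hν0 hν1 => isStdSubGaussian_map_div hZ hmean hvar (NNReal.coe_pos.2 hν0)
      (lintegral_exp_sq_div_le_two hν1)
  -- The bound 1 ≤ κ for every admissible ν keeps the norm away from zero, which makes it strictly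
  -- smaller than its double.
  have hlow : ENNReal.ofReal √(Var[Z; P]) ≤ subGaussianNorm Z P := by
    refine le_iInf₂ fun ν hν => ?_
    have := (hstd ν hν.1 hν.2).one_le
    rw [le_div_iff₀ hσ, one_mul] at this
    exact ENNReal.ofReal_le_of_le_toReal (by simpa using this)
  have hpos : subGaussianNorm Z P ≠ 0 := ((ENNReal.ofReal_pos.2 hσ).trans_le hlow).ne'
  have hlt : subGaussianNorm Z P < 2 * subGaussianNorm Z P := by
    rw [two_mul]; exact ENNReal.lt_add_right hsub.ne hpos
  obtain ⟨ν, hν⟩ := iInf_lt_iff.1 hlt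
  obtain ⟨⟨hν0, hν1⟩, hν2⟩ := iInf_lt_iff.1 hν
  refine ⟨ν / √(Var[Z; P]), ?_, hstd ν hν0 hν1⟩
  rw [subGaussianRatio, ← mul_div_assoc]
  gcongr
  have := ENNReal.toReal_mono (ENNReal.mul_ne_top (by simp) hsub.ne) hν2.le
  simpa using this

/-! ### Scale invariance and conclusion -/

lemma selfNormalize_div {n : ℕ} (x : Fin n → ℝ) {σ : ℝ} (hσ : 0 < σ) :
    selfNormalize (fun i => x i / σ) = selfNormalize x := by
  ext i
  simp only [selfNormalize, div_pow, ← Finset.sum_div]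
  rw [Real.sqrt_div' _ (sq_nonneg σ), Real.sqrt_sq hσ.le, div_div_div_cancel_right₀ hσ.ne']

lemma measurable_quadForm_selfNormalize {n : ℕ} (A : Matrix (Fin n) (Fin n) ℝ) :
    Measurable fun x : Fin n → ℝ => quadForm A (selfNormalize x) := by
  simp only [quadForm, selfNormalize, dotProduct, Matrix.mulVec]
  fun_prop

lemma integrable_quadForm_selfNormalize {n : ℕ} (A : Matrix (Fin n) (Fin n) ℝ)
    (Q : Measure (Fin n → ℝ)) [IsFiniteMeasure Q] :
    Integrable (fun x : Fin n → ℝ => quadForm A (selfNormalize x)) Q :=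
  (integrable_const (matrixOpNorm A)).mono'
    (measurable_quadForm_selfNormalize A).aestronglyMeasurable
    (.of_forall fun x => abs_quadForm_selfNormalize_le A x)

theorem mainTheorem8 :
    ∃ C : ℝ, 0 < C ∧ ∃ c : ℝ, 0 < c ∧
      ∀ {Ω' : Type*} [MeasurableSpace Ω'] (P' : Measure Ω') [IsProbabilityMeasure P']
        (ξ : Ω' → ℝ), AEMeasurable ξ P' → IsNondegenerate ξ P' → P'[ξ] = 0 →
        IsSubGaussian ξ P' →
      ∀ {Ω : Type*} [MeasurableSpace Ω] (P : Measure Ω) [IsProbabilityMeasure P]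
        (n : ℕ), 1 ≤ n → ∀ (X : Fin n → Ω → ℝ),
        iIndepFun X P → (∀ i, IdentDistrib (X i) ξ P P') →
      ∀ (A : Matrix (Fin n) (Fin n) ℝ), A ≠ 0 → ∀ t : ℝ, 0 < t →
        P.real {ω | t ≤ |quadForm A (selfNormalize fun i => X i ω)
            - ∫ ω', quadForm A (selfNormalize fun i => X i ω') ∂P|} ≤
          C * Real.exp (-c * min
            (n * t ^ 2 / (subGaussianRatio ξ P' ^ 4 * matrixOpNorm A ^ 2))
            (n * t / (subGaussianRatio ξ P' ^ 2 * matrixOpNorm A))) := by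

  -- 819200 = 12800 · 4 · 2⁴: the factor 4 comes from recentering at the mean, and 2⁴ from κ ≤ 2K.
  refine ⟨6 * Real.exp 36, by positivity, 1 / 819200, by norm_num, ?_⟩
  intro Ω' _ P' _ ξ hξ hnd hmean hsub Ω _ P _ n hn X hX hid A hA t ht
  obtain ⟨hvar, κ, hκ2, hstd⟩ := exists_isStdSubGaussian_map_div hξ hmean hnd hsub
  set σ := √(Var[ξ; P'])
  have hσ : 0 < σ := Real.sqrt_pos.2 hvar
  have hμ : IsProbabilityMeasure (P'.map fun ω => ξ ω / σ) :=
    Measure.isProbabilityMeasure_map (hξ.div_const _)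
  set Y : Ω → Fin n → ℝ := fun ω i => X i ω / σ
  have hYi : ∀ i, AEMeasurable (fun ω => X i ω / σ) P := fun i =>
    (hid i).aemeasurable_fst.div_const σ
  have hY : AEMeasurable Y P := aemeasurable_pi_lambda _ hYi
  have hlaw : P.map Y = Measure.pi fun _ : Fin n => P'.map fun ω => ξ ω / σ := by
    have h1 := (iIndepFun_iff_map_fun_eq_pi_map hYi).1
      (hX.comp (fun _ y => y / σ) fun _ => by fun_prop)
    refine h1.trans (congrArg Measure.pi (funext fun i => ?_))
    exact ((hid i).comp (u := fun y => y / σ) (by fun_prop)).map_eq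
  have hF := measurable_quadForm_selfNormalize A
  have hm := integral_map hY hF.aestronglyMeasurable
  have hself : ∀ ω, selfNormalize (fun i => X i ω) = selfNormalize (Y ω) := fun ω =>
    (selfNormalize_div _ hσ).symm
  simp_rw [hself]
  change P.real (Y ⁻¹' {x | t ≤ |quadForm A (selfNormalize x) -
    ∫ ω', quadForm A (selfNormalize (Y ω')) ∂P|}) ≤ _
  rw [← hm, ← map_measureReal_apply_of_aemeasurable hY
    (measurableSet_le measurable_const (by fun_prop)), hlaw]
  have hL := matrixOpNorm_pos hA
  have hn' : (0 : ℝ) < n := by exact_mod_cast hn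
  have hκ := hstd.pos
  refine (measureReal_abs_sub_integral_ge_le (integrable_quadForm_selfNormalize A _)
    (b := n / (12800 * κ ^ 4 * matrixOpNorm A ^ 2)) (by positivity)
    (fun t ht => measureReal_abs_quadForm_sub_trace_ge_le hstd hn hA ht) ht).trans ?_
  gcongr
  rw [neg_mul, neg_le_neg_iff]
  set K := subGaussianRatio ξ P'
  calc 1 / 819200 * min (n * t ^ 2 / (K ^ 4 * matrixOpNorm A ^ 2)) (n * t / (K ^ 2 * matrixOpNorm A))
      ≤ 1 / 819200 * (n * t ^ 2 / (K ^ 4 * matrixOpNorm A ^ 2)) := by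
        gcongr; exact min_le_left _ _
    _ = n * t ^ 2 / (51200 * (2 * K) ^ 4 * matrixOpNorm A ^ 2) := by
        rw [one_div_mul_eq_div, div_div]; ring_nf
    _ ≤ n * t ^ 2 / (51200 * κ ^ 4 * matrixOpNorm A ^ 2) := by gcongr
    _ = _ := by field_simp; norm_num
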